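/- Let $n\ge 2$ and let $\Gamma\subseteq\mathbb{R}^n$ be an open convex cone with vertex at the origin, symmetric under permutations of the coordinates, with $\Gamma\supseteq\Gamma_n=\{\lambda\in\mathbb R^n:\lambda_i>0,\ 1\le i\le n\}$. Let $f\in C^2(\Gamma)\cap C(\overline\Gamma)$ be a symmetric function such that $f_i=\partial f/\partial\lambda_i>0$ in $\Gamma$ for $1\le i\le n$, $f$ is concave in $\Gamma$, $f>0$ in $\Gamma$ and $f=0$ on $\partial\Gamma$. Let $\Omega\subset\mathbb R^n$ be a bounded domain with smooth boundary, $\psi\in C^\infty(\overline\Omega)$ with $\psi\ge 0$ in $\Omega$, and $\varphi\in C^\infty(\partial\Omega)$. Let $\varepsilon_0>0$ be such that $\varepsilon_0\le f(\mu)$ for some $\mu\in\Gamma$, and let $\eta\in C^\infty[0,\infty)$ satisfy $0\le\eta\le1$, $\eta=1$ on $[0,\varepsilon_0/4]$ and $\eta=0$ on $[\varepsilon_0/2,\infty)$. For $\gamma>0$ and $0<\varepsilon\le\varepsilon_0/2$ consider the approximating problem $$ f\big(\lambda[D^2u+\gamma\Delta u\, I]\big)=\psi+\varepsilon\,\eta(\psi)\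 \text{ in }\Omega,\qquad u=\varphi\ \text{ on }\partial\Omega, \tag{P} $$ where $\lambda[A]=(\lambda_1,\dots,\lambda_n)$ denotes the eigenvalues of a symmetric matrix $A$. A solution $u\in C^4(\Omega)\cap C(\overline\Omega)$ of (P) is called admissible if $\lambda[D^2u+\gamma\Delta u\,I]\in\overline\Gamma$ in $\Omega$. **Theorem 4.1.** For all real numbers $\Lambda$, $K$ and $d>0$ there is a constant $C$, depending only on $\Lambda$, $d$, $K$ and the data $n,\Gamma,f,\Omega,\psi,\varphi,\varepsilon_0,\eta$ (in particular not on $\varepsilon$), such that the following holds. Let $\gamma>0$ with $\gamma^{-1}\le\Lambda$, let $0<\varepsilon\le\varepsilon_0/2$, let $u$ be an admissible solution of (P) with $|u|_{C^1(\overline\Omega)}=\sup_\Omega|u|+\sup_\Omega|Du|\le K$, and let $\Omega'\subset\subset\Omega$ with $\mathrm{dist}(\Omega',\partial\Omega)\ge d$. Then $$\sup_{\overline{\Omega'}}|D^2u|\le C .$$ The existence of a subsolution of (P) is not assumed. -/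

import Mathlib

open scoped ContDiff ENNReal

noncomputable section

namespace HessianEq

/-- Real Euclidean `n`-space. -/
abbrev E (n : ℕ) : Type := EuclideanSpace ℝ (Fin n)

/-- The Hessian matrix `D²u(x)`, with entries `∂ᵢ∂ⱼu(x)`. -/
def hessian {n : ℕ} (u : E n → ℝ) (x : E n) : Matrix (Fin n) (Fin n) ℝ :=
  Matrix.of fun i j =>
    fderiv ℝ (fderiv ℝ u) x (EuclideanSpace.single i 1) (EuclideanSpace.single j 1)

/-- The matrix `D²u(x) + γ Δu(x) I`; the Laplacian is the trace of the Hessian. -/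
def augHessian {n : ℕ} (γ : ℝ) (u : E n → ℝ) (x : E n) : Matrix (Fin n) (Fin n) ℝ :=
  hessian u x + (γ * (hessian u x).trace) • (1 : Matrix (Fin n) (Fin n) ℝ)

/-- The norm `|D²u(x)| = (∑ᵢⱼ uᵢⱼ(x)²)^(1/2)`. -/
def hessianNorm {n : ℕ} (u : E n → ℝ) (x : E n) : ℝ :=
  Real.sqrt (∑ i, ∑ j, hessian u x i j ^ 2)

open Classical in
/-- The eigenvalues `λ[A] = (λ₁, …, λₙ)`, with multiplicity, of a real symmetric matrix `A`
(junk value `0` otherwise). It is only ever used through symmetric sets and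
symmetric functions, so that the order of the eigenvalues is immaterial. -/
def eigenvalueVector {n : ℕ} (A : Matrix (Fin n) (Fin n) ℝ) : Fin n → ℝ :=
  if h : A.IsHermitian then h.eigenvalues else 0

/-- `Γ` is an open convex symmetric cone with vertex at the origin which contains the
positive cone `Γₙ`. -/
structure IsSymmetricCone {n : ℕ} (Γ : Set (Fin n → ℝ)) : Prop where
  isOpen : IsOpen Γ
  convex : Convex ℝ Γ
  symm : ∀ (σ : Equiv.Perm (Fin n)), ∀ l ∈ Γ, l ∘ σ ∈ Γ
  smul_mem : ∀ t : ℝ, 0 < t → ∀ l ∈ Γ, t • l ∈ Γ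
  positive_subset : {l : Fin n → ℝ | ∀ i, 0 < l i} ⊆ Γ

/-- The structure conditions on the symmetric function `f ∈ C²(Γ) ∩ C(closure Γ)`. -/
structure StructureConditions {n : ℕ} (Γ : Set (Fin n → ℝ)) (f : (Fin n → ℝ) → ℝ) : Prop where
  cone : IsSymmetricCone Γ
  symm : ∀ (σ : Equiv.Perm (Fin n)), ∀ l ∈ closure Γ, f (l ∘ σ) = f l
  contDiffOn : ContDiffOn ℝ 2 f Γ
  continuousOn : ContinuousOn f (closure Γ)
  /-- `fᵢ = ∂f/∂λᵢ > 0` in `Γ`. -/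
  partial_pos : ∀ l ∈ Γ, ∀ i, 0 < fderiv ℝ f l (Pi.single i 1)
  concave : ConcaveOn ℝ Γ f
  pos : ∀ l ∈ Γ, 0 < f l
  zero_on_boundary : ∀ l ∈ frontier Γ, f l = 0

/-- `Ω` is a bounded domain (nonempty, open, connected) with smooth boundary: near each of its
boundary points, `Ω` is the negativity set of a smooth function with nonvanishing differential. -/
structure IsBoundedSmoothDomain {n : ℕ} (Ω : Set (E n)) : Prop where
  isOpen : IsOpen Ω
  isConnected : IsConnected Ω
  isBounded : Bornology.IsBounded Ω
  smooth_boundary : ∀ p ∈ frontier Ω, ∃ U : Set (E n), IsOpen U ∧ p ∈ U ∧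
    ∃ ρ : E n → ℝ, ContDiffOn ℝ ∞ ρ U ∧ fderiv ℝ ρ p ≠ 0 ∧ Ω ∩ U = {x ∈ U | ρ x < 0}

/-- The cutoff function `η ∈ C^∞[0, ∞)` of the approximating problem. -/
structure IsCutoff (ε₀ : ℝ) (η : ℝ → ℝ) : Prop where
  contDiffOn : ContDiffOn ℝ ∞ η (Set.Ici 0)
  eq_one : ∀ t ∈ Set.Icc 0 (ε₀ / 4), η t = 1
  eq_zero : ∀ t ∈ Set.Ici (ε₀ / 2), η t = 0
  nonneg : ∀ t ∈ Set.Ici (0 : ℝ), 0 ≤ η t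
  le_one : ∀ t ∈ Set.Ici (0 : ℝ), η t ≤ 1

/-- `u ∈ C⁴(Ω) ∩ C(closure Ω)` is an admissible solution of the approximating Dirichlet problem
`f(λ[D²u + γ Δu I]) = ψ + ε η(ψ)` in `Ω`, `u = φ` on `∂Ω`. -/
structure IsAdmissibleSolution {n : ℕ} (Γ : Set (Fin n → ℝ)) (f : (Fin n → ℝ) → ℝ)
    (Ω : Set (E n)) (ψ φ : E n → ℝ) (η : ℝ → ℝ) (γ ε : ℝ) (u : E n → ℝ) : Prop where
  contDiffOn : ContDiffOn ℝ 4 u Ω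
  continuousOn : ContinuousOn u (closure Ω)
  admissible : ∀ x ∈ Ω, eigenvalueVector (augHessian γ u x) ∈ closure Γ
  equation : ∀ x ∈ Ω, f (eigenvalueVector (augHessian γ u x)) = ψ x + ε * η (ψ x)
  boundary : ∀ x ∈ frontier Ω, u x = φ x

/-- The `C¹` norm `sup |u| + sup |Du|`, with values in `[0, ∞]`. The suprema are over the open
set `Ω`; for `u ∈ C¹(closure Ω)` they are the same as those over `closure Ω`. -/
def c1Norm {n : ℕ} (Ω : Set (E n)) (u : E n → ℝ) : ℝ≥0∞ :=
  (⨆ x ∈ Ω, ‖u x‖ₑ) + ⨆ x ∈ Ω, ‖fderiv ℝ u x‖ₑ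

/-- The distance `inf {|x - y| : x ∈ A, y ∈ B}` of two sets, with values in `[0, ∞]`. -/
def setDist {n : ℕ} (A B : Set (E n)) : ℝ≥0∞ := ⨅ x ∈ A, ⨅ y ∈ B, edist x y

end HessianEq

end

open HessianEq

/-!
The estimate is a maximum principle argument for the equation `F(D²u + γ Δu I) = h`, where
`F(A) = f(λ[A])` and `h = ψ + ε η(ψ)`, with the test function `Q = ζ² u_ξξ + |Du|²` on a ball
`B_r(y)`, `ζ = r² - |z - y|²`, for a fixed unit vector `ξ`.

The term `γ Δu I` makes the equation uniformly elliptic. At a point with eigenvalues `λ ∈ Γ` the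
linearized operator is, in an eigenbasis, `L = ∑ᵢ cᵢ ∂ᵢᵢ` with `cᵢ = fᵢ + γ T`, `T = ∑ₖ fₖ(λ)`, so
that `cᵢ` lies between `γ T` and `(1 + γ) T`. No differentiability of `F` is needed: the diagonal
of `A` in the eigenbasis of `A₀` is a doubly stochastic image of `λ[A]`, so that Birkhoff's theorem
and the concavity of `f` show that `A ↦ ∑ᵢ fᵢ(λ) ⟨eᵢ, A eᵢ⟩` is a supergradient of `F` at `A₀`
(`StructureConditions.le_supergradient`). Hence `L u - h`, with the coefficients frozen at `x`, has
a minimum at `x` (`exists_linearization`), and there `L ∂ₖu = ∂ₖh` and `L u_ξξ ≥ h_ξξ`.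

At an interior maximum point of `Q` these relations leave an inequality
`2θ X² ≤ a X + b` for `X = ζ |D²u|`, since `L |Du|²` contributes the square of the full Hessian
(`cutoff_mul_le_of_isLocalMax`). This bounds `ζ u_ξξ` there and so `u_ξξ` at the centre
(`dirDeriv_dirDeriv_center_le`). Upper bounds of all `u_ξξ` suffice, because `Δu ≥ 0`: the cone
lies in the half-space `∑ᵢ λᵢ ≥ 0` (`StructureConditions.sum_nonneg`, `hessianNorm_le`).

The constants do not depend on `ε` or on an upper bound of `γ`. The ratio `γ / (1 + γ)` is
controlled by `γ⁻¹ ≤ Λ`, the derivatives of `h` are bounded uniformly in `ε` (`exists_bound_rhs`),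
and `T` is bounded from below by concavity, as `f` takes in `Γ` a value larger than all
right-hand sides on the relevant compact set (`StructureConditions.le_sum_partial`,
`IsAdmissibleSolution.exists_rhs_le`).
-/

open Set Filter Topology

/-! ### Directional derivatives and derivative tests -/

section DirDeriv

variable {V : Type*} [NormedAddCommGroup V] [NormedSpace ℝ V]

/-- The directional derivative `∂ᵥw(x)`, as a function of `x`. -/
noncomputable def dirDeriv (v : V) (w : V → ℝ) (x : V) : ℝ := fderiv ℝ w x v

theorem ContDiffOn.dirDeriv {U : Set V} (hU : IsOpen U) {w : V → ℝ} {m k : ℕ∞ω}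
    (hw : ContDiffOn ℝ m w U) (hk : k + 1 ≤ m) (v : V) : ContDiffOn ℝ k (dirDeriv v w) U :=
  (hw.fderiv_of_isOpen hU hk).clm_apply contDiffOn_const

theorem dirDeriv_congr {U : Set V} (hU : IsOpen U) {f g : V → ℝ} (h : EqOn f g U) (v : V) :
    EqOn (dirDeriv v f) (dirDeriv v g) U := by
  intro x hx
  have : f =ᶠ[𝓝 x] g := h.eventuallyEq_of_mem (hU.mem_nhds hx)
  simp only [dirDeriv, this.fderiv_eq]

theorem dirDeriv_dirDeriv {w : V → ℝ} {x : V} (hw : ContDiffAt ℝ 2 w x) (v v' : V) :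
    dirDeriv v (dirDeriv v' w) x = fderiv ℝ (fderiv ℝ w) x v v' := by
  have h : DifferentiableAt ℝ (fderiv ℝ w) x :=
    (hw.fderiv_right (m := 1) (by norm_num)).differentiableAt (by norm_num)
  have := h.hasFDerivAt.clm_apply (hasFDerivAt_const v' x)
  unfold dirDeriv
  rw [this.fderiv]
  simp

theorem dirDeriv_comm {U : Set V} (hU : IsOpen U) {w : V → ℝ} (hw : ContDiffOn ℝ 2 w U)
    (v v' : V) : EqOn (dirDeriv v (dirDeriv v' w)) (dirDeriv v' (dirDeriv v w)) U := by
  intro x hx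
  have h := hw.contDiffAt (hU.mem_nhds hx)
  rw [dirDeriv_dirDeriv h, dirDeriv_dirDeriv h]
  exact h.isSymmSndFDerivAt (by simp) v v'

theorem dirDeriv_dirDeriv_dirDeriv_comm {U : Set V} (hU : IsOpen U) {w : V → ℝ}
    (hw : ContDiffOn ℝ 3 w U) (v v' : V) :
    EqOn (dirDeriv v (dirDeriv v' (dirDeriv v' w))) (dirDeriv v' (dirDeriv v' (dirDeriv v w)))
      U := by
  intro x hx
  rw [dirDeriv_comm hU (hw.dirDeriv hU (by norm_num) v') v v' hx]
  exact dirDeriv_congr hU (dirDeriv_comm hU (hw.of_le (by norm_num)) v v') v' hx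

theorem hasDerivAt_comp_line {w : V → ℝ} {x v : V} {t : ℝ}
    (hw : DifferentiableAt ℝ w (x + t • v)) :
    HasDerivAt (fun s : ℝ => w (x + s • v)) (dirDeriv v w (x + t • v)) t := by
  have h : HasDerivAt (fun s : ℝ => x + s • v) v t := by
    simpa using ((hasDerivAt_id t).smul_const v).const_add x
  exact hw.hasFDerivAt.comp_hasDerivAt t h

theorem tendsto_line (x v : V) : Tendsto (fun s : ℝ => x + s • v) (𝓝 0) (𝓝 x) := by
  have : Continuous fun s : ℝ => x + s • v := by fun_prop
  simpa using this.tendsto 0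

theorem eventually_hasDerivAt_comp_line {U : Set V} (hU : IsOpen U) {w : V → ℝ}
    (hw : ContDiffOn ℝ 1 w U) {x : V} (hx : x ∈ U) (v : V) :
    ∀ᶠ t : ℝ in 𝓝 0, HasDerivAt (fun s : ℝ => w (x + s • v)) (dirDeriv v w (x + t • v)) t := by
  filter_upwards [(tendsto_line x v).eventually (hU.mem_nhds hx)] with t ht
  exact hasDerivAt_comp_line ((hw.contDiffAt (hU.mem_nhds ht)).differentiableAt (by norm_num))

theorem hasDerivAt_comp_line_zero {U : Set V} (hU : IsOpen U) {w : V → ℝ}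
    (hw : ContDiffOn ℝ 1 w U) {x : V} (hx : x ∈ U) (v : V) :
    HasDerivAt (fun s : ℝ => w (x + s • v)) (dirDeriv v w x) 0 := by
  simpa using (eventually_hasDerivAt_comp_line hU hw hx v).self_of_nhds

/-- The necessary first- and second-order conditions at a local maximum. By the sufficient
second-derivative test a positive second derivative would force a local minimum as well, hence a
locally constant function. -/
theorem second_deriv_nonpos_of_isLocalMax {φ φ' : ℝ → ℝ} {φ'' : ℝ}
    (h1 : ∀ᶠ t in 𝓝 0, HasDerivAt φ (φ' t) t) (h2 : HasDerivAt φ' φ'' 0)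
    (hmax : IsLocalMax φ 0) : φ'' ≤ 0 ∧ φ' 0 = 0 := by
  have hd : deriv φ =ᶠ[𝓝 0] φ' := h1.mono fun t ht => ht.deriv
  have h0 : φ' 0 = 0 := by rw [← hd.self_of_nhds]; exact hmax.deriv_eq_zero
  refine ⟨?_, h0⟩
  by_contra! hpos
  have hdd : deriv (deriv φ) 0 = φ'' := by rw [hd.deriv_eq, h2.deriv]
  have hmin := isLocalMin_of_deriv_deriv_pos (f := φ) (x₀ := 0) (by rw [hdd]; exact hpos)
    (by rw [hd.self_of_nhds, h0]) h1.self_of_nhds.continuousAt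
  have hc : φ =ᶠ[𝓝 0] fun _ => φ 0 := by
    filter_upwards [hmin, hmax] with t a b
    exact le_antisymm b a
  have hc' : deriv φ =ᶠ[𝓝 0] fun _ => 0 := by
    filter_upwards [hc.eventuallyEq_nhds] with t ht
    rw [ht.deriv_eq]; simp
  rw [hc'.deriv_eq] at hdd
  simp at hdd
  exact hpos.ne hdd

theorem IsLocalMax.comp_line {Q : V → ℝ} {x : V} (h : IsLocalMax Q x) (v : V) :
    IsLocalMax (fun s : ℝ => Q (x + s • v)) 0 := by
  have := (tendsto_line x v).eventually h
  simpa [IsLocalMax, IsMaxFilter] using this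

/-- First- and second-order conditions at a local maximum of `q w + ∑ₖ pₖ²`. -/
theorem dirDeriv_mul_add_sum_sq_of_isLocalMax {ι : Type*} [Fintype ι] {U : Set V}
    (hU : IsOpen U) {q w : V → ℝ} {p : ι → V → ℝ} (hq : ContDiffOn ℝ 2 q U)
    (hw : ContDiffOn ℝ 2 w U) (hp : ∀ k, ContDiffOn ℝ 2 (p k) U) {x : V} (hx : x ∈ U)
    (hmax : IsLocalMax (fun y => q y * w y + ∑ k, p k y ^ 2) x) (v : V) :
    dirDeriv v q x * w x + q x * dirDeriv v w x + ∑ k, 2 * p k x * dirDeriv v (p k) x = 0 ∧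
    dirDeriv v (dirDeriv v q) x * w x + 2 * (dirDeriv v q x * dirDeriv v w x)
      + q x * dirDeriv v (dirDeriv v w) x
      + ∑ k, 2 * (dirDeriv v (p k) x ^ 2 + p k x * dirDeriv v (dirDeriv v (p k)) x) ≤ 0 := by
  have l1 : (1 : ℕ∞ω) ≤ 2 := by norm_num
  have l2 : (1 : ℕ∞ω) + 1 ≤ 2 := by norm_num
  have e1 : ∀ᶠ t : ℝ in 𝓝 0, HasDerivAt
      (fun s : ℝ => q (x + s • v) * w (x + s • v) + ∑ k, p k (x + s • v) ^ 2)
      (dirDeriv v q (x + t • v) * w (x + t • v) + q (x + t • v) * dirDeriv v w (x + t • v)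
        + ∑ k, 2 * p k (x + t • v) * dirDeriv v (p k) (x + t • v)) t := by
    have hpe := Filter.eventually_all.2 fun k =>
      eventually_hasDerivAt_comp_line hU ((hp k).of_le l1) hx v
    filter_upwards [eventually_hasDerivAt_comp_line hU (hq.of_le l1) hx v,
      eventually_hasDerivAt_comp_line hU (hw.of_le l1) hx v, hpe] with t a b c
    refine (a.mul b).add (HasDerivAt.fun_sum fun k _ => ?_)
    simpa using (c k).fun_pow 2
  have Q := hasDerivAt_comp_line_zero hU (hq.of_le l1) hx v
  have W := hasDerivAt_comp_line_zero hU (hw.of_le l1) hx v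
  have P := fun k => hasDerivAt_comp_line_zero hU ((hp k).of_le l1) hx v
  have Q' := hasDerivAt_comp_line_zero hU (hq.dirDeriv hU l2 v) hx v
  have W' := hasDerivAt_comp_line_zero hU (hw.dirDeriv hU l2 v) hx v
  have P' := fun k => hasDerivAt_comp_line_zero hU ((hp k).dirDeriv hU l2 v) hx v
  have e2 := ((Q'.mul W).add (Q.mul W')).add
    (HasDerivAt.fun_sum (u := Finset.univ) fun k _ => ((P k).const_mul 2).mul (P' k))
  obtain ⟨h2, h1⟩ := second_deriv_nonpos_of_isLocalMax e1 e2 (hmax.comp_line v)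
  simp only [zero_smul, add_zero] at h1 h2
  refine ⟨h1, le_of_eq_of_le ?_ h2⟩
  have : ∑ k, 2 * (dirDeriv v (p k) x ^ 2 + p k x * dirDeriv v (dirDeriv v (p k)) x)
      = ∑ k, (2 * dirDeriv v (p k) x * dirDeriv v (p k) x
        + 2 * p k x * dirDeriv v (dirDeriv v (p k)) x) :=
    Finset.sum_congr rfl fun k _ => by ring
  rw [this]
  ring

/-- First- and second-order conditions at a local minimum of `∑ᵢ cᵢ wᵢ - h`. -/
theorem dirDeriv_sum_mul_of_isLocalMin {ι : Type*} [Fintype ι] {U : Set V} (hU : IsOpen U)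
    {c : ι → ℝ} {w : ι → V → ℝ} {h : V → ℝ} (hw : ∀ i, ContDiffOn ℝ 2 (w i) U)
    (hh : ContDiffOn ℝ 2 h U) {x : V} (hx : x ∈ U)
    (hmin : IsLocalMin (fun y => ∑ i, c i * w i y - h y) x) (v : V) :
    ∑ i, c i * dirDeriv v (w i) x = dirDeriv v h x ∧
    dirDeriv v (dirDeriv v h) x ≤ ∑ i, c i * dirDeriv v (dirDeriv v (w i)) x := by
  have l1 : (1 : ℕ∞ω) ≤ 2 := by norm_num
  have l2 : (1 : ℕ∞ω) + 1 ≤ 2 := by norm_num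
  have e1 : ∀ᶠ t : ℝ in 𝓝 0, HasDerivAt
      (fun s : ℝ => h (x + s • v) - ∑ i, c i * w i (x + s • v))
      (dirDeriv v h (x + t • v) - ∑ i, c i * dirDeriv v (w i) (x + t • v)) t := by
    have hpe := Filter.eventually_all.2 fun k =>
      eventually_hasDerivAt_comp_line hU ((hw k).of_le l1) hx v
    filter_upwards [eventually_hasDerivAt_comp_line hU (hh.of_le l1) hx v, hpe] with t a c
    exact a.sub (HasDerivAt.fun_sum fun k _ => (c k).const_mul _)
  have H' := hasDerivAt_comp_line_zero hU (hh.dirDeriv hU l2 v) hx v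
  have W' := fun k => hasDerivAt_comp_line_zero hU ((hw k).dirDeriv hU l2 v) hx v
  have e2 := H'.sub (HasDerivAt.fun_sum (u := Finset.univ) fun k _ => (W' k).const_mul (c k))
  have hmax : IsLocalMax (fun y => h y - ∑ i, c i * w i y) x := by
    filter_upwards [hmin] with y hy
    linarith
  obtain ⟨h2, h1⟩ := second_deriv_nonpos_of_isLocalMax e1 e2 (hmax.comp_line v)
  simp only [zero_smul, add_zero] at h1
  exact ⟨by linarith, by linarith⟩

end DirDeriv

/-! ### Symmetric concave functions on symmetric cones -/

section Cone

variable {n : ℕ} {Γ : Set (Fin n → ℝ)} {f : (Fin n → ℝ) → ℝ}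

theorem fderiv_apply_eq_sum (l v : Fin n → ℝ) :
    fderiv ℝ f l v = ∑ i, fderiv ℝ f l (Pi.single i 1) * v i := by
  conv_lhs => rw [pi_eq_sum_univ' v]
  simp [mul_comm]

theorem HessianEq.IsSymmetricCone.add_mem (hΓ : IsSymmetricCone Γ) {l m : Fin n → ℝ} (hl : l ∈ Γ)
    (hm : m ∈ Γ) : l + m ∈ Γ := by
  have h := hΓ.convex (hΓ.smul_mem 2 two_pos l hl) (hΓ.smul_mem 2 two_pos m hm)
    (a := 1 / 2) (b := 1 / 2) (by norm_num) (by norm_num) (by norm_num)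
  simpa [smul_smul] using h

/-- A concave function lies below its tangent plane. -/
theorem HessianEq.StructureConditions.le_tangent (hf : StructureConditions Γ f) {l m : Fin n → ℝ}
    (hl : l ∈ Γ) (hm : m ∈ Γ) : f m ≤ f l + fderiv ℝ f l (m - l) := by
  have hc := hf.concave.comp_affineMap (AffineMap.lineMap l m)
  have hd := hasDerivAt_comp_line_zero hf.cone.isOpen (hf.contDiffOn.of_le (by norm_num)) hl (m - l)
  have he : (f ∘ AffineMap.lineMap l m : ℝ → ℝ) = fun s : ℝ => f (l + s • (m - l)) := by
    funext s
    simp [AffineMap.lineMap_apply, add_comm]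
  rw [he] at hc
  have := hc.slope_le_of_hasDerivAt (x := 0) (y := 1) (by simpa using hl) (by simpa using hm)
    one_pos hd
  simp [slope_def_field, dirDeriv] at this
  simp only [map_sub]
  linarith

/-- A function positive on a cone and concave has nonnegative radial derivative. -/
theorem HessianEq.StructureConditions.fderiv_self_nonneg (hf : StructureConditions Γ f)
    {l : Fin n → ℝ} (hl : l ∈ Γ) : 0 ≤ fderiv ℝ f l l := by
  by_contra! hneg
  have hfl := hf.pos l hl
  -- the parameter at which the tangent along the ray vanishes
  set t : ℝ := 1 + f l / (-fderiv ℝ f l l) with ht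
  have htp : 0 < t := by
    have := div_pos hfl (neg_pos.2 hneg)
    linarith
  have h1 := hf.le_tangent hl (hf.cone.smul_mem t htp l hl)
  have h2 := hf.pos _ (hf.cone.smul_mem t htp l hl)
  have h3 : fderiv ℝ f l (t • l - l) = (t - 1) * fderiv ℝ f l l := by
    rw [map_sub, map_smul, smul_eq_mul]; ring
  have hne := hneg.ne
  have h4 : (t - 1) * fderiv ℝ f l l = - f l := by
    rw [ht, div_neg]; field_simp; ring
  linarith

theorem HessianEq.StructureConditions.sum_partial_pos [NeZero n] (hf : StructureConditions Γ f)
    {l : Fin n → ℝ} (hl : l ∈ Γ) : 0 < ∑ i, fderiv ℝ f l (Pi.single i 1) :=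
  Finset.sum_pos (fun i _ => hf.partial_pos l hl i) Finset.univ_nonempty

theorem HessianEq.IsSymmetricCone.one_mem (hΓ : IsSymmetricCone Γ) : (1 : Fin n → ℝ) ∈ Γ :=
  hΓ.positive_subset fun _ => by simp

theorem HessianEq.StructureConditions.exists_gt [NeZero n] (hf : StructureConditions Γ f)
    {l : Fin n → ℝ} (hl : l ∈ Γ) : ∃ m ∈ Γ, f l < f m := by
  have h1 := hf.cone.add_mem hl hf.cone.one_mem
  refine ⟨l + 1, h1, ?_⟩
  have h2 := hf.le_tangent h1 hl
  have h3 : fderiv ℝ f (l + 1) (l - (l + 1)) = - ∑ i, fderiv ℝ f (l + 1) (Pi.single i 1) := by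
    rw [fderiv_apply_eq_sum]; simp
  linarith [hf.sum_partial_pos h1]

/-- If `f` takes a value larger than `f(λ)`, then `∑ᵢ fᵢ(λ)` cannot be small. -/
theorem HessianEq.StructureConditions.le_sum_partial (hf : StructureConditions Γ f) {l μ : Fin n → ℝ}
    (hl : l ∈ Γ) (hμ : μ ∈ Γ) :
    f μ - f l ≤ ‖μ‖ * ∑ i, fderiv ℝ f l (Pi.single i 1) := by
  have h1 := hf.le_tangent hl hμ
  rw [map_sub] at h1
  have h2 := hf.fderiv_self_nonneg hl
  have h3 : fderiv ℝ f l μ ≤ ‖μ‖ * ∑ i, fderiv ℝ f l (Pi.single i 1) := by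
    rw [fderiv_apply_eq_sum, Finset.mul_sum]
    refine Finset.sum_le_sum fun i _ => ?_
    rw [mul_comm]
    exact mul_le_mul_of_nonneg_right ((le_abs_self _).trans (norm_le_pi_norm μ i))
      (hf.partial_pos l hl i).le
  linarith

/-- Doubly stochastic matrices map `Γ` into itself and do not decrease the symmetric concave
function `f`: by Birkhoff's theorem they are convex combinations of permutations. -/
theorem HessianEq.StructureConditions.le_of_doublyStochastic (hf : StructureConditions Γ f)
    {S : Matrix (Fin n) (Fin n) ℝ} (hS : S ∈ doublyStochastic ℝ (Fin n)) {μ : Fin n → ℝ}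
    (hμ : μ ∈ Γ) : S.mulVec μ ∈ Γ ∧ f μ ≤ f (S.mulVec μ) := by
  obtain ⟨w, hw0, hw1, rfl⟩ := exists_eq_sum_perm_of_mem_doublyStochastic hS
  have he : (∑ σ, w σ • Equiv.Perm.permMatrix ℝ σ).mulVec μ = ∑ σ, w σ • (μ ∘ σ) := by
    simp [Matrix.sum_mulVec, Matrix.smul_mulVec, Matrix.permMatrix_mulVec]
  rw [he]
  refine ⟨hf.cone.convex.sum_mem (fun σ _ => hw0 σ) hw1 fun σ _ => hf.cone.symm σ μ hμ, ?_⟩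
  have := hf.concave.le_map_sum (fun σ _ => hw0 σ) hw1 fun σ _ => hf.cone.symm σ μ hμ
  refine le_trans (le_of_eq ?_) this
  simp_rw [hf.symm _ _ (subset_closure hμ), smul_eq_mul, ← Finset.sum_mul, hw1, one_mul]

/-- The mean value `(∑ᵢ λᵢ / n)(1, …, 1)` of the permutations of `λ ∈ Γ` belongs to `Γ`. -/
theorem HessianEq.StructureConditions.average_mem [NeZero n] (hf : StructureConditions Γ f)
    {l : Fin n → ℝ} (hl : l ∈ Γ) : (fun _ => (n : ℝ)⁻¹ * ∑ i, l i) ∈ Γ := by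
  have hn : (n : ℝ) ≠ 0 := Nat.cast_ne_zero.2 (NeZero.ne n)
  have hS : (Matrix.of fun _ _ => (n : ℝ)⁻¹) ∈ doublyStochastic ℝ (Fin n) := by
    rw [mem_doublyStochastic_iff_sum]
    refine ⟨fun _ _ => by simp, fun _ => ?_, fun _ => ?_⟩ <;> simp [hn]
  convert (hf.le_of_doublyStochastic hS hl).1 using 1
  funext i
  simp [Matrix.mulVec, dotProduct, Finset.mul_sum]

/-- `∑ᵢ λᵢ ≥ 0` on the closure of `Γ`: otherwise the cone contains the ray through
`-(1, …, 1)`, along which the radial derivative of `f` is negative since all `fᵢ > 0`, against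
`fderiv_self_nonneg`. -/
theorem HessianEq.StructureConditions.sum_nonneg [NeZero n] (hf : StructureConditions Γ f)
    {l : Fin n → ℝ} (hl : l ∈ closure Γ) : 0 ≤ ∑ i, l i := by
  have hn : (0 : ℝ) < n := Nat.cast_pos.2 (NeZero.pos n)
  have key : ∀ l ∈ Γ, 0 ≤ ∑ i, l i := by
    intro l hl
    by_contra! hneg
    have hm := hf.average_mem hl
    have h1 := hf.fderiv_self_nonneg hm
    have h2 : fderiv ℝ f (fun _ => (n : ℝ)⁻¹ * ∑ i, l i) (fun _ => (n : ℝ)⁻¹ * ∑ i, l i) < 0 := by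
      rw [fderiv_apply_eq_sum, ← Finset.sum_mul]
      exact mul_neg_of_pos_of_neg (hf.sum_partial_pos hm)
        (mul_neg_of_pos_of_neg (inv_pos.2 hn) hneg)
    linarith
  have hcl : IsClosed {l : Fin n → ℝ | 0 ≤ ∑ i, l i} :=
    isClosed_le continuous_const (by fun_prop)
  exact closure_minimal key hcl hl

theorem HessianEq.StructureConditions.mem_of_pos (hf : StructureConditions Γ f) {l : Fin n → ℝ}
    (hl : l ∈ closure Γ) (hpos : 0 < f l) : l ∈ Γ := by
  by_contra hn
  have : l ∈ frontier Γ := ⟨hl, by rwa [hf.cone.isOpen.interior_eq]⟩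
  rw [hf.zero_on_boundary l this] at hpos
  exact lt_irrefl _ hpos

end Cone

/-! ### The function of the eigenvalues: a supergradient in the eigenbasis -/

section Spectral

variable {n : ℕ}

/-- The quadratic form `⟨v, A v⟩`. -/
noncomputable def quadForm (A : Matrix (Fin n) (Fin n) ℝ) (v : E n) : ℝ :=
  v.ofLp ⬝ᵥ A.mulVec v.ofLp

theorem Matrix.IsHermitian.quadForm_eq {A : Matrix (Fin n) (Fin n) ℝ} (hA : A.IsHermitian)
    (v : E n) :
    quadForm A v = ∑ j, inner ℝ v (hA.eigenvectorBasis j) ^ 2 * hA.eigenvalues j := by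
  have hin : ∀ x y : E n, inner ℝ x y = x.ofLp ⬝ᵥ y.ofLp := by
    intro x y
    rw [EuclideanSpace.inner_eq_star_dotProduct, dotProduct_comm]; simp
  have h1 : A.mulVec v.ofLp = ∑ j, (inner ℝ (hA.eigenvectorBasis j) v * hA.eigenvalues j) •
      (hA.eigenvectorBasis j).ofLp := by
    conv_lhs => rw [← hA.eigenvectorBasis.sum_repr' v]
    simp only [WithLp.ofLp_sum, WithLp.ofLp_smul, Matrix.mulVec_sum, Matrix.mulVec_smul,
      hA.mulVec_eigenvectorBasis, smul_smul]
  rw [quadForm, h1, dotProduct_sum]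
  refine Finset.sum_congr rfl fun j _ => ?_
  rw [dotProduct_smul, ← hin, real_inner_comm v, smul_eq_mul]
  ring

theorem Matrix.IsHermitian.quadForm_eigenvectorBasis {A : Matrix (Fin n) (Fin n) ℝ}
    (hA : A.IsHermitian) (i : Fin n) :
    quadForm A (hA.eigenvectorBasis i) = hA.eigenvalues i := by
  rw [hA.quadForm_eq]
  simp [OrthonormalBasis.inner_eq_ite]

theorem Matrix.IsHermitian.sum_quadForm {A : Matrix (Fin n) (Fin n) ℝ} (hA : A.IsHermitian)
    (e : OrthonormalBasis (Fin n) ℝ (E n)) : ∑ i, quadForm A (e i) = A.trace := by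
  simp_rw [hA.quadForm_eq]
  rw [Finset.sum_comm, hA.trace_eq_sum_eigenvalues]
  refine Finset.sum_congr rfl fun j _ => ?_
  rw [← Finset.sum_mul, e.sum_sq_inner_right]
  simp

theorem quadForm_add (A B : Matrix (Fin n) (Fin n) ℝ) (v : E n) :
    quadForm (A + B) v = quadForm A v + quadForm B v := by
  simp [quadForm, Matrix.add_mulVec]

theorem quadForm_smul_one (c : ℝ) (v : E n) :
    quadForm (c • (1 : Matrix (Fin n) (Fin n) ℝ)) v = c * ‖v‖ ^ 2 := by
  rw [EuclideanSpace.real_norm_sq_eq, Finset.mul_sum]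
  simp only [quadForm, Matrix.smul_mulVec, Matrix.one_mulVec, dotProduct, Pi.smul_apply, smul_eq_mul]
  exact Finset.sum_congr rfl fun i _ => by ring

/-- The squared scalar products of two orthonormal bases form a doubly stochastic matrix. -/
theorem OrthonormalBasis.sq_inner_mem_doublyStochastic
    (e b : OrthonormalBasis (Fin n) ℝ (E n)) :
    (Matrix.of fun i j => inner ℝ (e i) (b j) ^ 2) ∈ doublyStochastic ℝ (Fin n) := by
  rw [mem_doublyStochastic_iff_sum]
  refine ⟨fun i j => by simp [sq_nonneg], fun i => ?_, fun j => ?_⟩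
  · simp [b.sum_sq_inner_left]
  · simp [e.sum_sq_inner_right]

/-- With `λ` the eigenvalues of `A₀` and `e` its eigenbasis, `A ↦ ∑ᵢ fᵢ(λ) ⟨eᵢ, A eᵢ⟩` is a
supergradient of `A ↦ f(λ[A])` at `A₀`. It is enough to compare `λ[A]` with the diagonal of `A`
in the basis `e`, so that no differentiability of the eigenvalues is needed. -/
theorem HessianEq.StructureConditions.le_supergradient {Γ : Set (Fin n → ℝ)} {f : (Fin n → ℝ) → ℝ}
    (hf : StructureConditions Γ f) {A₀ A : Matrix (Fin n) (Fin n) ℝ} (hA₀ : A₀.IsHermitian)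
    (hA : A.IsHermitian) (h₀ : hA₀.eigenvalues ∈ Γ) (h : hA.eigenvalues ∈ Γ) :
    f hA.eigenvalues ≤ f hA₀.eigenvalues +
      ∑ i, fderiv ℝ f hA₀.eigenvalues (Pi.single i 1) *
        (quadForm A (hA₀.eigenvectorBasis i) - quadForm A₀ (hA₀.eigenvectorBasis i)) := by
  obtain ⟨h1, h2⟩ := hf.le_of_doublyStochastic
    (hA₀.eigenvectorBasis.sq_inner_mem_doublyStochastic hA.eigenvectorBasis) h
  have h3 := hf.le_tangent h₀ h1
  rw [fderiv_apply_eq_sum] at h3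
  refine (h2.trans h3).trans_eq ?_
  congr 1
  refine Finset.sum_congr rfl fun i _ => ?_
  rw [hA₀.quadForm_eigenvectorBasis, hA.quadForm_eq]
  simp [Matrix.mulVec, dotProduct]

end Spectral

/-! ### The Hessian matrix and second directional derivatives -/

section Hessian

variable {n : ℕ}

theorem OrthonormalBasis.sum_sq_apply (e : OrthonormalBasis (Fin n) ℝ (E n))
    (L : E n →L[ℝ] ℝ) : ∑ k, L (e k) ^ 2 = ‖L‖ ^ 2 := by
  rw [← (InnerProductSpace.toDual ℝ (E n)).symm.norm_map, ← e.sum_sq_inner_left]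
  simp

theorem quadForm_hessian {u : E n → ℝ} {x : E n} (hu : ContDiffAt ℝ 2 u x) (v : E n) :
    quadForm (hessian u x) v = dirDeriv v (dirDeriv v u) x := by
  rw [dirDeriv_dirDeriv hu]
  have hv : v = ∑ a, v a • EuclideanSpace.single a (1 : ℝ) := by
    conv_lhs => rw [← (EuclideanSpace.basisFun (Fin n) ℝ).sum_repr v]
    simp
  conv_rhs => rw [hv]
  simp only [map_sum, map_smul, sum_apply, smul_apply]
  simp only [quadForm, dotProduct, Matrix.mulVec, hessian, Matrix.of_apply, smul_eq_mul,
    Finset.mul_sum]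
  rw [Finset.sum_comm]
  refine Finset.sum_congr rfl fun i _ => Finset.sum_congr rfl fun j _ => ?_
  ring

theorem hessian_isHermitian {u : E n → ℝ} {x : E n} (hu : ContDiffAt ℝ 2 u x) :
    (hessian u x).IsHermitian := by
  ext i j
  simpa [hessian] using hu.isSymmSndFDerivAt (by simp) _ _

theorem augHessian_isHermitian {u : E n → ℝ} {x : E n} (hu : ContDiffAt ℝ 2 u x) (γ : ℝ) :
    (augHessian γ u x).IsHermitian := by
  refine (hessian_isHermitian hu).add ?_
  ext i j
  simp [Matrix.one_apply, eq_comm]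

theorem trace_augHessian (γ : ℝ) (u : E n → ℝ) (x : E n) :
    (augHessian γ u x).trace = (1 + n * γ) * (hessian u x).trace := by
  simp [augHessian]
  ring

theorem eigenvalueVector_eq {A : Matrix (Fin n) (Fin n) ℝ} (hA : A.IsHermitian) :
    eigenvalueVector A = hA.eigenvalues := by
  exact dif_pos hA

theorem quadForm_augHessian {u : E n → ℝ} {x : E n} (hu : ContDiffAt ℝ 2 u x) (γ : ℝ)
    {v : E n} (hv : ‖v‖ = 1) (e : OrthonormalBasis (Fin n) ℝ (E n)) :
    quadForm (augHessian γ u x) v =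
      dirDeriv v (dirDeriv v u) x + γ * ∑ k, dirDeriv (e k) (dirDeriv (e k) u) x := by
  rw [augHessian, quadForm_add, quadForm_smul_one, hv, quadForm_hessian hu,
    ← (hessian_isHermitian hu).sum_quadForm e]
  simp [quadForm_hessian hu]

/-- Bound of a second derivative by the Hilbert–Schmidt norm of the second derivatives in an
orthonormal basis. -/
theorem dirDeriv_dirDeriv_sq_le {u : E n → ℝ} {x : E n} (hu : ContDiffAt ℝ 2 u x) {ξ : E n}
    (hξ : ‖ξ‖ = 1) (e : OrthonormalBasis (Fin n) ℝ (E n)) :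
    dirDeriv ξ (dirDeriv ξ u) x ^ 2 ≤ ∑ i, ∑ k, dirDeriv (e i) (dirDeriv (e k) u) x ^ 2 := by
  simp_rw [dirDeriv_dirDeriv hu]
  have hsymm : ∀ v w, fderiv ℝ (fderiv ℝ u) x v w = fderiv ℝ (fderiv ℝ u) x w v :=
    hu.isSymmSndFDerivAt (by simp)
  have hle : ∀ L : E n →L[ℝ] ℝ, L ξ ^ 2 ≤ ‖L‖ ^ 2 := fun L => by
    rw [sq_le_sq, abs_norm]
    simpa [hξ] using L.le_opNorm ξ
  refine (hle _).trans ?_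
  rw [← e.sum_sq_apply]
  refine Finset.sum_le_sum fun i _ => ?_
  rw [hsymm, e.sum_sq_apply]
  exact hle _

end Hessian

/-! ### The cutoff factor -/

section Cutoff

variable {n : ℕ} (r : ℝ) (y : E n)

theorem contDiff_cutoff {k : ℕ∞ω} : ContDiff ℝ k fun z : E n => (r ^ 2 - ‖z - y‖ ^ 2) ^ 2 :=
  (contDiff_const.sub ((contDiff_id.sub contDiff_const).norm_sq ℝ)).pow 2

theorem hasFDerivAt_sub_normSq (z : E n) :
    HasFDerivAt (fun z : E n => r ^ 2 - ‖z - y‖ ^ 2) (-(2 • innerSL ℝ (z - y))) z := by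
  simpa using (((hasFDerivAt_id z).sub_const y).norm_sq).const_sub (r ^ 2)

theorem dirDeriv_cutoff (v : E n) :
    dirDeriv v (fun z : E n => (r ^ 2 - ‖z - y‖ ^ 2) ^ 2) =
      fun z => -4 * ((r ^ 2 - ‖z - y‖ ^ 2) * inner ℝ (z - y) v) := by
  funext z
  rw [dirDeriv, ((hasFDerivAt_sub_normSq r y z).pow 2).fderiv]
  simp [inner_sub_left]
  ring

theorem dirDeriv_dirDeriv_cutoff (v z : E n) :
    dirDeriv v (dirDeriv v fun z : E n => (r ^ 2 - ‖z - y‖ ^ 2) ^ 2) z =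
      8 * inner ℝ (z - y) v ^ 2 - 4 * (r ^ 2 - ‖z - y‖ ^ 2) * ‖v‖ ^ 2 := by
  rw [dirDeriv_cutoff]
  have h1 : HasFDerivAt (fun z : E n => inner ℝ (z - y) v) (innerSL ℝ v) z := by
    have := ((innerSL ℝ v).hasFDerivAt (x := z - y)).comp z ((hasFDerivAt_id z).sub_const y)
    simpa [Function.comp_def, real_inner_comm] using this
  rw [dirDeriv, (((hasFDerivAt_sub_normSq r y z).fun_mul h1).const_mul (-4)).fderiv]
  simp only [smul_apply, add_apply, smul_eq_mul,
    neg_apply, innerSL_apply_apply, real_inner_self_eq_norm_sq, nsmul_eq_mul]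
  simp
  ring

end Cutoff

/-! ### The estimate at a maximum point -/

section MaxPoint

variable {n : ℕ}

theorem le_of_sq_le_mul_add {X a b t : ℝ} (ht : 0 < t) (ha : 0 ≤ a) (hb : 0 ≤ b)
    (h : t * X ^ 2 ≤ a * X + b) : X ≤ 1 + (a + b) / t := by
  by_contra! hlt
  have h0 : 0 ≤ (a + b) / t := by positivity
  have h1 : 1 < X := by linarith
  have h2 : a + b < t * (X - 1) := by
    rw [← div_lt_iff₀' ht]; linarith
  nlinarith [mul_le_mul_of_nonneg_left h1.le hb]

theorem abs_sum_mul_le {ι : Type*} [Fintype ι] {p q : ι → ℝ} {A B : ℝ} (hA : 0 ≤ A) (hB : 0 ≤ B)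
    (hp : ∑ k, p k ^ 2 ≤ A ^ 2) (hq : ∑ k, q k ^ 2 ≤ B ^ 2) : |∑ k, p k * q k| ≤ A * B := by
  refine abs_le_of_sq_le_sq ?_ (by positivity)
  rw [mul_pow]
  exact (Finset.sum_mul_sq_le_sq_mul_sq _ _ _).trans
    (mul_le_mul hp hq (Finset.sum_nonneg fun _ _ => sq_nonneg _) (sq_nonneg _))

/-- The two conditions at the maximum point in one direction, combined: `ζ` is the cutoff, `a` its
derivative, `w, w₁, w₂` stand for `u_ξξ` and its derivatives, `G = ⟨Du, ∂Du⟩`, and `P` collects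
the second derivatives of `|Du|²`. -/
theorem directional_estimate {ζ a w w₁ w₂ G P r K s : ℝ} (hζ : 0 < ζ) (hw : 0 ≤ w)
    (hr : 0 ≤ r) (hζr : ζ ≤ r ^ 2) (ha : |a| ≤ 2 * r) (hG : |G| ≤ K * s)
    (h1 : 2 * ζ * a * w + ζ ^ 2 * w₁ + 2 * G = 0)
    (h2 : (2 * a ^ 2 - 4 * ζ) * w + 2 * (2 * ζ * a * w₁) + ζ ^ 2 * w₂ + P ≤ 0) :
    ζ ^ 2 * w₂ + P ≤ 36 * r ^ 2 * w + 16 * r * K * s / ζ := by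
  -- The vanishing gradient eliminates the third derivatives `w₁`.
  have e : ζ * w₁ = -(2 * a * w) - 2 * G / ζ := by
    field_simp
    linarith
  have e' : 2 * (2 * ζ * a * w₁) = -(8 * a ^ 2 * w) - 8 * (a * G) / ζ := by
    calc 2 * (2 * ζ * a * w₁) = 4 * a * (ζ * w₁) := by ring
      _ = _ := by rw [e]; ring
  have ha2 : a ^ 2 ≤ 4 * r ^ 2 := by
    have := sq_le_sq' (by linarith [(abs_le.1 ha).1]) (abs_le.1 ha).2
    linarith
  have haG : a * G ≤ 2 * r * (K * s) := by
    refine (le_abs_self _).trans ?_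
    rw [abs_mul]
    exact mul_le_mul ha hG (abs_nonneg _) (by linarith)
  have h3 : 8 * (a * G) / ζ ≤ 16 * r * K * s / ζ :=
    div_le_div_of_nonneg_right (by linarith) hζ.le
  have h4 : a ^ 2 * w ≤ 4 * r ^ 2 * w := by gcongr
  have h5 : ζ * w ≤ r ^ 2 * w := by gcongr
  have h6 : 0 ≤ a ^ 2 * w := by positivity
  nlinarith

/-- At an interior maximum point of `ζ² u_ξξ + |Du|²`, where `ζ = r² - |z - y|²`, the equation
controls `ζ u_ξξ`. The equation enters through an operator `∑ᵢ cᵢ ∂ᵢᵢ` with constant coefficients,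
comparable to `M`, for which `∑ᵢ cᵢ ∂ᵢᵢu - h` has a local minimum at the same point. -/
theorem cutoff_mul_le_of_isLocalMax {U : Set (E n)} (hU : IsOpen U) {u h : E n → ℝ}
    (hu : ContDiffOn ℝ 4 u U) (hh : ContDiffOn ℝ 2 h U) {x : E n} (hx : x ∈ U)
    (e : OrthonormalBasis (Fin n) ℝ (E n)) {c : Fin n → ℝ} {θ M m : ℝ} (hθ : 0 < θ)
    (hm : 0 < m) (hmM : m ≤ M) (hcθ : ∀ i, θ * M ≤ c i) (hcM : ∀ i, c i ≤ M)
    (hmin : IsLocalMin (fun z => ∑ i, c i * dirDeriv (e i) (dirDeriv (e i) u) z - h z) x)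
    {ξ : E n} (hξ : ‖ξ‖ = 1) {K H₁ H₂ : ℝ} (hK : ‖fderiv ℝ u x‖ ≤ K)
    (hH₁ : ‖fderiv ℝ h x‖ ≤ H₁) (hH₂ : |dirDeriv ξ (dirDeriv ξ h) x| ≤ H₂)
    {y : E n} {r : ℝ} (hr : 0 < r) (hζ : 0 < r ^ 2 - ‖x - y‖ ^ 2)
    (hmax : IsLocalMax (fun z => (r ^ 2 - ‖z - y‖ ^ 2) ^ 2 * dirDeriv ξ (dirDeriv ξ u) z +
      ‖fderiv ℝ u z‖ ^ 2) x)
    (hw : 0 ≤ dirDeriv ξ (dirDeriv ξ u) x) :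
    (r ^ 2 - ‖x - y‖ ^ 2) * dirDeriv ξ (dirDeriv ξ u) x ≤
      1 + (n * (36 * r ^ 4 + 16 * r * K) + (r ^ 4 * H₂ + 2 * K * H₁) / m * r ^ 4) / (2 * θ) := by
  have hK0 : 0 ≤ K := (norm_nonneg _).trans hK
  have hH₁0 : 0 ≤ H₁ := (norm_nonneg _).trans hH₁
  have hH₂0 : 0 ≤ H₂ := (abs_nonneg _).trans hH₂
  have hM : 0 < M := hm.trans_le hmM
  have hc0 : ∀ i, 0 ≤ c i := fun i => (mul_pos hθ hM).le.trans (hcθ i)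
  set ζ := r ^ 2 - ‖x - y‖ ^ 2 with hζdef
  have hζr : ζ ≤ r ^ 2 := by rw [hζdef]; linarith [sq_nonneg ‖x - y‖]
  have hxr : ‖x - y‖ ≤ r := abs_le_of_sq_le_sq' (by linarith) hr.le |>.2
  -- regularity of the derivatives
  have hu3 : ∀ v, ContDiffOn ℝ 3 (dirDeriv v u) U := fun v => hu.dirDeriv hU (by norm_num) v
  have hu2 : ∀ v v', ContDiffOn ℝ 2 (dirDeriv v (dirDeriv v' u)) U :=
    fun v v' => (hu3 v').dirDeriv hU (by norm_num) v
  have hux : ContDiffAt ℝ 2 u x := (hu.contDiffAt (hU.mem_nhds hx)).of_le (by norm_num)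
  set w := dirDeriv ξ (dirDeriv ξ u) with hwdef
  set p : Fin n → E n → ℝ := fun k => dirDeriv (e k) u with hp
  set s : ℝ := √(∑ i, ∑ k, dirDeriv (e i) (p k) x ^ 2) with hs
  have hs0 : 0 ≤ s := Real.sqrt_nonneg _
  have hs2 : s ^ 2 = ∑ i, ∑ k, dirDeriv (e i) (p k) x ^ 2 :=
    Real.sq_sqrt (Finset.sum_nonneg fun _ _ => Finset.sum_nonneg fun _ _ => sq_nonneg _)
  have hws : w x ≤ s := Real.le_sqrt_of_sq_le (dirDeriv_dirDeriv_sq_le hux hξ e)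
  have hpK : ∑ k, p k x ^ 2 ≤ K ^ 2 := by
    have : ∑ k, p k x ^ 2 = ‖fderiv ℝ u x‖ ^ 2 := e.sum_sq_apply _
    rw [this]
    exact pow_le_pow_left₀ (norm_nonneg _) hK 2
  have hpH : ∑ k, dirDeriv (e k) h x ^ 2 ≤ H₁ ^ 2 := by
    have : ∑ k, dirDeriv (e k) h x ^ 2 = ‖fderiv ℝ h x‖ ^ 2 := e.sum_sq_apply _
    rw [this]
    exact pow_le_pow_left₀ (norm_nonneg _) hH₁ 2
  -- the conditions from the minimum of the linearized equation
  have hmin' := dirDeriv_sum_mul_of_isLocalMin hU (fun i => hu2 (e i) (e i)) hh hx hmin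
  have hL1 : ∀ k, ∑ i, c i * dirDeriv (e i) (dirDeriv (e i) (p k)) x = dirDeriv (e k) h x := by
    intro k
    rw [← (hmin' (e k)).1]
    refine Finset.sum_congr rfl fun i _ => ?_
    rw [dirDeriv_dirDeriv_dirDeriv_comm hU (hu.of_le (by norm_num)) (e k) (e i) hx]
  have hL2 : -H₂ ≤ ∑ i, c i * dirDeriv (e i) (dirDeriv (e i) w) x := by
    refine ((abs_le.1 hH₂).1.trans (hmin' ξ).2).trans_eq ?_
    refine Finset.sum_congr rfl fun i _ => ?_
    congr 1
    rw [dirDeriv_congr hU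
      (dirDeriv_dirDeriv_dirDeriv_comm hU (hu.of_le (by norm_num)) ξ (e i)) ξ hx]
    exact dirDeriv_dirDeriv_dirDeriv_comm hU (hu3 ξ) ξ (e i) hx
  -- the conditions from the maximum of the test function
  have hQ : IsLocalMax (fun z => (r ^ 2 - ‖z - y‖ ^ 2) ^ 2 * w z + ∑ k, p k z ^ 2) x := by
    have : ∀ z, ∑ k, p k z ^ 2 = ‖fderiv ℝ u z‖ ^ 2 := fun z => e.sum_sq_apply _
    simpa only [this] using hmax
  set R := 36 * r ^ 2 * w x + 16 * r * K * s / ζ with hR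
  have hdir : ∀ i, ζ ^ 2 * dirDeriv (e i) (dirDeriv (e i) w) x +
      ∑ k, 2 * (dirDeriv (e i) (p k) x ^ 2 + p k x * dirDeriv (e i) (dirDeriv (e i) (p k)) x)
        ≤ R := by
    intro i
    obtain ⟨h1, h2⟩ := dirDeriv_mul_add_sum_sq_of_isLocalMax hU
      (contDiff_cutoff r y).contDiffOn (hu2 ξ ξ) (fun k => (hu3 (e k)).of_le (by norm_num)) hx
      hQ (e i)
    rw [dirDeriv_dirDeriv_cutoff] at h2
    rw [dirDeriv_cutoff] at h1 h2
    simp only [← hζdef, e.norm_eq_one] at h1 h2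
    have hai : |inner ℝ (x - y) (e i)| ≤ r := by
      refine (abs_real_inner_le_norm _ _).trans ?_
      rw [e.norm_eq_one, mul_one]
      exact hxr
    have hG : |∑ k, p k x * dirDeriv (e i) (p k) x| ≤ K * s := by
      refine abs_sum_mul_le hK0 hs0 hpK ?_
      rw [hs2]
      exact Finset.single_le_sum (f := fun i => ∑ k, dirDeriv (e i) (p k) x ^ 2)
        (fun _ _ => Finset.sum_nonneg fun _ _ => sq_nonneg _) (Finset.mem_univ i)
    refine directional_estimate (a := -2 * inner ℝ (x - y) (e i))
      (w₁ := dirDeriv (e i) w x) hζ hw hr.le hζr ?_ hG ?_ ?_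
    · rw [abs_mul]
      norm_num
      exact hai
    · rw [Finset.mul_sum]
      simp only [← mul_assoc]
      simp only [mul_assoc] at h1 ⊢
      linarith
    · linarith
  have hw0 : (0 : ℝ) ≤ R := by positivity
  -- sum over the directions with the weights `c i`
  have hsum := Finset.sum_le_sum fun i (_ : i ∈ Finset.univ) =>
    mul_le_mul_of_nonneg_left (hdir i) (hc0 i)
  have hright : ∑ i, c i * R ≤ n * (M * R) := by
    calc ∑ i, c i * R ≤ ∑ _i : Fin n, M * R :=
          Finset.sum_le_sum fun i _ => mul_le_mul_of_nonneg_right (hcM i) hw0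
      _ = n * (M * R) := by simp
  have hleft : ∑ i, c i * (ζ ^ 2 * dirDeriv (e i) (dirDeriv (e i) w) x +
      ∑ k, 2 * (dirDeriv (e i) (p k) x ^ 2 + p k x * dirDeriv (e i) (dirDeriv (e i) (p k)) x))
      = ζ ^ 2 * ∑ i, c i * dirDeriv (e i) (dirDeriv (e i) w) x
        + 2 * ∑ i, c i * ∑ k, dirDeriv (e i) (p k) x ^ 2
        + 2 * ∑ k, p k x * dirDeriv (e k) h x := by
    simp only [← hL1, mul_add, Finset.sum_add_distrib, Finset.mul_sum]
    rw [Finset.sum_comm (f := fun k i => 2 * (p k x * (c i * _))), add_assoc]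
    congr 1
    · exact Finset.sum_congr rfl fun i _ => by ring
    congr 1
    · exact Finset.sum_congr rfl fun i _ => Finset.sum_congr rfl fun k _ => by ring
    · exact Finset.sum_congr rfl fun i _ => Finset.sum_congr rfl fun k _ => by ring
  have hquad : θ * M * s ^ 2 ≤ ∑ i, c i * ∑ k, dirDeriv (e i) (p k) x ^ 2 := by
    rw [hs2, Finset.mul_sum]
    exact Finset.sum_le_sum fun i _ => mul_le_mul_of_nonneg_right (hcθ i)
      (Finset.sum_nonneg fun _ _ => sq_nonneg _)
  have hgrad : -(K * H₁) ≤ ∑ k, p k x * dirDeriv (e k) h x :=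
    (abs_le.1 (abs_sum_mul_le hK0 hH₁0 hpK hpH)).1
  have hζ2 : ζ ^ 2 ≤ r ^ 4 := by
    calc ζ ^ 2 ≤ (r ^ 2) ^ 2 := pow_le_pow_left₀ hζ.le hζr 2
      _ = r ^ 4 := by ring
  have hH : ζ ^ 2 * -H₂ ≤ ζ ^ 2 * ∑ i, c i * dirDeriv (e i) (dirDeriv (e i) w) x :=
    mul_le_mul_of_nonneg_left hL2 (sq_nonneg _)
  have hH' : ζ ^ 2 * H₂ ≤ r ^ 4 * H₂ := mul_le_mul_of_nonneg_right hζ2 hH₂0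
  set B := (r ^ 4 * H₂ + 2 * K * H₁) / m with hB
  have hB0 : 0 ≤ B := by positivity
  have hBM : r ^ 4 * H₂ + 2 * K * H₁ ≤ M * B := by
    calc r ^ 4 * H₂ + 2 * K * H₁ = m * B := by rw [hB]; field_simp
      _ ≤ M * B := mul_le_mul_of_nonneg_right hmM hB0
  -- All terms carry the factor `M`, so that its size is irrelevant.
  have hmain : 2 * θ * s ^ 2 ≤ n * R + B := by
    refine le_of_mul_le_mul_left ?_ hM
    linarith
  -- the quadratic inequality for `ζ s`
  have hX : 2 * θ * (ζ * s) ^ 2 ≤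
      n * (36 * r ^ 4 + 16 * r * K) * (ζ * s) + B * r ^ 4 := by
    have h1 : ζ ^ 2 * R ≤ (36 * r ^ 4 + 16 * r * K) * (ζ * s) := by
      have e1 : ζ ^ 2 * R = 36 * r ^ 2 * (ζ * (ζ * w x)) + 16 * r * K * (ζ * s) := by
        rw [hR]; field_simp
      have e2 : ζ * (ζ * w x) ≤ r ^ 2 * (ζ * s) := by gcongr
      rw [e1]
      nlinarith [mul_le_mul_of_nonneg_left e2 (by positivity : (0 : ℝ) ≤ 36 * r ^ 2)]
    calc 2 * θ * (ζ * s) ^ 2 = ζ ^ 2 * (2 * θ * s ^ 2) := by ring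
      _ ≤ ζ ^ 2 * (n * R + B) := by gcongr
      _ = n * (ζ ^ 2 * R) + B * ζ ^ 2 := by ring
      _ ≤ n * ((36 * r ^ 4 + 16 * r * K) * (ζ * s)) + B * r ^ 4 := by gcongr
      _ = _ := by ring
  have hfin := le_of_sq_le_mul_add (X := ζ * s) (b := B * r ^ 4) (by linarith : 0 < 2 * θ)
    (by positivity) (mul_nonneg hB0 (by positivity)) hX
  exact (mul_le_mul_of_nonneg_left hws hζ.le).trans hfin

end MaxPoint

/-! ### The interior estimate on a ball -/

section Interior

variable {n : ℕ}

/-- With `L = ∑ᵢ cᵢ ∂ᵢᵢ` the operator given by the supergradient at the point `x`, the function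
`L u - f(λ[D²u + γ Δu I])` has a minimum at `x`. The coefficients `cᵢ = fᵢ + γ ∑ₖ fₖ` are
comparable to `(1 + γ) ∑ₖ fₖ`, with ratio depending only on a lower bound of `γ`. -/
theorem exists_linearization {Γ : Set (Fin n → ℝ)} {f : (Fin n → ℝ) → ℝ}
    (hf : StructureConditions Γ f) {U : Set (E n)} (hU : IsOpen U) {u h : E n → ℝ}
    (hu : ContDiffOn ℝ 2 u U) {γ θ : ℝ} (hγ : 0 < γ) (hθ : θ * (1 + γ) ≤ γ)
    (hΓ : ∀ z ∈ U, eigenvalueVector (augHessian γ u z) ∈ Γ)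
    (heq : ∀ z ∈ U, f (eigenvalueVector (augHessian γ u z)) = h z) {x : E n} (hx : x ∈ U)
    {m : ℝ}
    (hm : m ≤ ∑ i, fderiv ℝ f (eigenvalueVector (augHessian γ u x)) (Pi.single i 1)) :
    ∃ (e : OrthonormalBasis (Fin n) ℝ (E n)) (c : Fin n → ℝ) (M : ℝ), m ≤ M ∧
      (∀ i, θ * M ≤ c i) ∧ (∀ i, c i ≤ M) ∧
      IsLocalMin (fun z => ∑ i, c i * dirDeriv (e i) (dirDeriv (e i) u) z - h z) x := by
  have hu2 : ∀ z ∈ U, ContDiffAt ℝ 2 u z := fun z hz => hu.contDiffAt (hU.mem_nhds hz)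
  have hA : ∀ z ∈ U, (augHessian γ u z).IsHermitian :=
    fun z hz => augHessian_isHermitian (hu2 z hz) γ
  have hl : (hA x hx).eigenvalues ∈ Γ := eigenvalueVector_eq (hA x hx) ▸ hΓ x hx
  rw [eigenvalueVector_eq (hA x hx)] at hm
  set e := (hA x hx).eigenvectorBasis
  set g : Fin n → ℝ := fun i => fderiv ℝ f (hA x hx).eigenvalues (Pi.single i 1) with hg
  have hg0 : ∀ i, 0 ≤ g i := fun i => (hf.partial_pos _ hl i).le
  set T := ∑ i, g i with hT
  have hT0 : 0 ≤ T := Finset.sum_nonneg fun i _ => hg0 i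
  have hgT : ∀ i, g i ≤ T := fun i => Finset.single_le_sum (fun k _ => hg0 k) (Finset.mem_univ i)
  refine ⟨e, fun i => g i + γ * T, (1 + γ) * T, ?_, fun i => ?_, fun i => ?_, ?_⟩
  · linarith [mul_nonneg hγ.le hT0]
  · have := mul_le_mul_of_nonneg_right hθ hT0
    linarith [hg0 i]
  · linarith [hgT i]
  have hform : ∀ z ∈ U, ∑ i, g i * quadForm (augHessian γ u z) (e i) =
      ∑ i, (g i + γ * T) * dirDeriv (e i) (dirDeriv (e i) u) z := by
    intro z hz
    simp only [quadForm_augHessian (hu2 z hz) γ (e.norm_eq_one _) e, mul_add, add_mul,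
      Finset.sum_add_distrib]
    congr 1
    rw [← Finset.sum_mul, ← Finset.mul_sum, ← hT]
    ring
  filter_upwards [hU.mem_nhds hx] with z hz
  have hlz : (hA z hz).eigenvalues ∈ Γ := eigenvalueVector_eq (hA z hz) ▸ hΓ z hz
  have h1 := hf.le_supergradient (hA x hx) (hA z hz) hl hlz
  simp only [mul_sub, Finset.sum_sub_distrib] at h1
  have h2 := heq x hx
  have h3 := heq z hz
  rw [eigenvalueVector_eq (hA x hx)] at h2
  rw [eigenvalueVector_eq (hA z hz)] at h3
  rw [h2, h3] at h1
  have h4 := hform x hx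
  have h5 := hform z hz
  simp only [hg] at h4 h5 ⊢
  linarith

/-- Interior bound from above for the pure second derivatives at the centre of a ball. -/
theorem dirDeriv_dirDeriv_center_le {Γ : Set (Fin n → ℝ)} {f : (Fin n → ℝ) → ℝ}
    (hf : StructureConditions Γ f) {U : Set (E n)} (hU : IsOpen U) {u h : E n → ℝ}
    (hu : ContDiffOn ℝ 4 u U) (hh : ContDiffOn ℝ 2 h U) {γ θ : ℝ} (hγ : 0 < γ) (hθ0 : 0 < θ)
    (hθ : θ * (1 + γ) ≤ γ) (hΓ : ∀ z ∈ U, eigenvalueVector (augHessian γ u z) ∈ Γ)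
    (heq : ∀ z ∈ U, f (eigenvalueVector (augHessian γ u z)) = h z)
    {y : E n} {r : ℝ} (hr : 0 < r) (hyr : Metric.closedBall y r ⊆ U) {K H₁ H₂ m : ℝ} (hm : 0 < m)
    (hK : ∀ z ∈ Metric.closedBall y r, ‖fderiv ℝ u z‖ ≤ K)
    (hH₁ : ∀ z ∈ Metric.closedBall y r, ‖fderiv ℝ h z‖ ≤ H₁)
    (hH₂ : ∀ z ∈ Metric.closedBall y r, ∀ ξ : E n, ‖ξ‖ = 1 → |dirDeriv ξ (dirDeriv ξ h) z| ≤ H₂)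
    (hT : ∀ z ∈ Metric.closedBall y r,
      m ≤ ∑ i, fderiv ℝ f (eigenvalueVector (augHessian γ u z)) (Pi.single i 1))
    {ξ : E n} (hξ : ‖ξ‖ = 1) :
    dirDeriv ξ (dirDeriv ξ u) y ≤ (r ^ 2 * (1 + (n * (36 * r ^ 4 + 16 * r * K) +
      (r ^ 4 * H₂ + 2 * K * H₁) / m * r ^ 4) / (2 * θ)) + K ^ 2) / r ^ 4 := by
  have hyy : y ∈ Metric.closedBall y r := Metric.mem_closedBall_self hr.le
  have hK0 : 0 ≤ K := (norm_nonneg _).trans (hK y hyy)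
  have hH₁0 : 0 ≤ H₁ := (norm_nonneg _).trans (hH₁ y hyy)
  have hH₂0 : 0 ≤ H₂ := (abs_nonneg _).trans (hH₂ y hyy ξ hξ)
  set C := 1 + (n * (36 * r ^ 4 + 16 * r * K) +
      (r ^ 4 * H₂ + 2 * K * H₁) / m * r ^ 4) / (2 * θ) with hC
  have hC0 : 0 ≤ C := by positivity
  set w := dirDeriv ξ (dirDeriv ξ u) with hwdef
  have hwc : ContinuousOn w U :=
    (((hu.dirDeriv (k := 3) hU (by norm_num) ξ).dirDeriv (k := 2) hU (by norm_num) ξ)).continuousOn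
  have hQc : ContinuousOn (fun z => (r ^ 2 - ‖z - y‖ ^ 2) ^ 2 * w z + ‖fderiv ℝ u z‖ ^ 2)
      (Metric.closedBall y r) := by
    refine ((contDiff_cutoff (k := 0) r y).continuous.continuousOn.mul (hwc.mono hyr)).add ?_
    exact ((hu.continuousOn_fderiv_of_isOpen hU (by norm_num)).mono hyr).norm.pow 2
  obtain ⟨x, hx, hxmax⟩ := (isCompact_closedBall y r).exists_isMaxOn ⟨y, hyy⟩ hQc
  have hxr : ‖x - y‖ ≤ r := by simpa [dist_eq_norm] using hx
  have hζ0 : 0 ≤ r ^ 2 - ‖x - y‖ ^ 2 := by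
    have := pow_le_pow_left₀ (norm_nonneg _) hxr 2
    linarith
  have hζr : r ^ 2 - ‖x - y‖ ^ 2 ≤ r ^ 2 := by linarith [sq_nonneg ‖x - y‖]
  have hDu : ‖fderiv ℝ u x‖ ^ 2 ≤ K ^ 2 := pow_le_pow_left₀ (norm_nonneg _) (hK x hx) 2
  have hζw : (r ^ 2 - ‖x - y‖ ^ 2) * w x ≤ C := by
    rcases hζ0.eq_or_lt with h0 | hpos
    · rw [← h0, zero_mul]; exact hC0
    rcases le_total (w x) 0 with hneg | hw
    · exact (mul_nonpos_of_nonneg_of_nonpos hζ0 hneg).trans hC0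
    have hxlt : ‖x - y‖ < r := lt_of_pow_lt_pow_left₀ 2 hr.le (by linarith)
    have hnhds : Metric.closedBall y r ∈ 𝓝 x :=
      mem_of_superset (Metric.isOpen_ball.mem_nhds (by simpa [dist_eq_norm] using hxlt))
        Metric.ball_subset_closedBall
    obtain ⟨e, c, M, hmM, hcθ, hcM, hmin⟩ :=
      exists_linearization hf hU (hu.of_le (by norm_num)) hγ hθ hΓ heq (hyr hx) (hT x hx)
    exact cutoff_mul_le_of_isLocalMax hU hu hh (hyr hx) e hθ0 hm hmM hcθ hcM hmin hξ (hK x hx)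
      (hH₁ x hx) (hH₂ x hx ξ hξ) hr hpos (hxmax.isLocalMax hnhds) hw
  have hy := hxmax hyy
  simp only [mem_ofPred_eq, sub_self, norm_zero] at hy
  rw [le_div_iff₀ (by positivity)]
  have h1 : (r ^ 2 - ‖x - y‖ ^ 2) ^ 2 * w x ≤ r ^ 2 * C := by
    calc (r ^ 2 - ‖x - y‖ ^ 2) ^ 2 * w x
        = (r ^ 2 - ‖x - y‖ ^ 2) * ((r ^ 2 - ‖x - y‖ ^ 2) * w x) := by ring
      _ ≤ (r ^ 2 - ‖x - y‖ ^ 2) * C := mul_le_mul_of_nonneg_left hζw hζ0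
      _ ≤ r ^ 2 * C := mul_le_mul_of_nonneg_right hζr hC0
  have h2 : (r ^ 2 - 0 ^ 2) ^ 2 * w y = w y * r ^ 4 := by ring
  rw [h2] at hy
  linarith [sq_nonneg ‖fderiv ℝ u y‖]

/-- An upper bound for the pure second derivatives bounds the whole Hessian if the Laplacian is
nonnegative. -/
theorem hessianNorm_le {u : E n → ℝ} {x : E n} (hu : ContDiffAt ℝ 2 u x) {b : ℝ} (hb : 0 ≤ b)
    (hle : ∀ ξ : E n, ‖ξ‖ = 1 → dirDeriv ξ (dirDeriv ξ u) x ≤ b)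
    (htr : 0 ≤ (hessian u x).trace) : hessianNorm u x ≤ n * ((n + 1) * b) := by
  set D := fderiv ℝ (fderiv ℝ u) x with hD
  have hquad : ∀ v : E n, D v v ≤ b * ‖v‖ ^ 2 := by
    intro v
    rcases eq_or_ne v 0 with rfl | hv
    · simp
    have hv' : ‖v‖ ≠ 0 := norm_ne_zero_iff.2 hv
    have h1 := hle (‖v‖⁻¹ • v) (by rw [norm_smul, norm_inv, norm_norm, inv_mul_cancel₀ hv'])
    rw [dirDeriv_dirDeriv hu, ← hD] at h1
    simp only [map_smul, smul_apply, smul_eq_mul] at h1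
    have h2 : D v v = ‖v‖⁻¹ * (‖v‖⁻¹ * D v v) * ‖v‖ ^ 2 := by field_simp
    rw [h2]
    exact mul_le_mul_of_nonneg_right h1 (sq_nonneg _)
  have hent : ∀ i j, hessian u x i j = D (EuclideanSpace.single i 1) (EuclideanSpace.single j 1) :=
    fun i j => rfl
  have hsymm : ∀ v w, D v w = D w v := hu.isSymmSndFDerivAt (by simp)
  have hone : ∀ i : Fin n, ‖(EuclideanSpace.single i (1 : ℝ) : E n)‖ = 1 := by simp
  have hdiag : ∀ i, hessian u x i i ≤ b := fun i => by
    simpa [hent, hone] using hquad (EuclideanSpace.single i 1)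
  have hdiag' : ∀ i, -((n - 1) * b) ≤ hessian u x i i := by
    intro i
    have h1 : (hessian u x).trace =
        hessian u x i i + ∑ k ∈ Finset.univ.erase i, hessian u x k k :=
      (Finset.add_sum_erase _ (fun k => hessian u x k k) (Finset.mem_univ i)).symm
    have h2 : ∑ k ∈ Finset.univ.erase i, hessian u x k k ≤ (n - 1) * b := by
      refine (Finset.sum_le_card_nsmul _ _ b fun k _ => hdiag k).trans_eq ?_
      have hn : 1 ≤ n := Nat.one_le_iff_ne_zero.2 (NeZero.of_pos i.pos).ne
      rw [Finset.card_erase_of_mem (Finset.mem_univ i), Finset.card_univ, Fintype.card_fin,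
        nsmul_eq_mul, Nat.cast_sub hn, Nat.cast_one]
    linarith
  have hle' : ∀ v w : E n, ‖v‖ = 1 → ‖w‖ = 1 → ‖v + w‖ ^ 2 ≤ 4 := by
    intro v w hv hw
    have h1 := pow_le_pow_left₀ (norm_nonneg _) (norm_add_le v w) 2
    rw [hv, hw] at h1
    linarith
  have hent_le : ∀ i j, hessian u x i j ^ 2 ≤ ((n + 1) * b) ^ 2 := by
    intro i j
    have hplus := (hquad (EuclideanSpace.single i 1 + EuclideanSpace.single j 1)).trans
      (mul_le_mul_of_nonneg_left (hle' _ _ (hone i) (hone j)) hb)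
    have hminus := (hquad (EuclideanSpace.single i 1 + -EuclideanSpace.single j 1)).trans
      (mul_le_mul_of_nonneg_left (hle' _ _ (hone i) (by rw [norm_neg, hone j])) hb)
    simp only [map_add, map_neg, add_apply, neg_apply] at hplus hminus
    rw [hsymm (EuclideanSpace.single j 1) (EuclideanSpace.single i 1)] at hplus hminus
    simp only [← hent] at hplus hminus
    have h1 := hdiag' i
    have h2 := hdiag' j
    exact sq_le_sq' (by linarith) (by linarith)
  refine Real.sqrt_le_iff.2 ⟨by positivity, ?_⟩
  calc ∑ i, ∑ j, hessian u x i j ^ 2 ≤ ∑ _i : Fin n, ∑ _j : Fin n, ((n + 1) * b) ^ 2 :=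
        Finset.sum_le_sum fun i _ => Finset.sum_le_sum fun j _ => hent_le i j
    _ = (n * ((n + 1) * b)) ^ 2 := by simp; ring

end Interior

/-! ### Uniform bounds for the data -/

section Data

variable {n : ℕ}

theorem exists_bound_derivatives {Ω S : Set (E n)} (hΩ : IsOpen Ω) (hS : IsCompact S) (hSΩ : S ⊆ Ω)
    {g : E n → ℝ} (hg : ContDiffOn ℝ 2 g Ω) :
    ∃ B, 0 ≤ B ∧ ∀ x ∈ S, ‖fderiv ℝ g x‖ ≤ B ∧ ‖fderiv ℝ (fderiv ℝ g) x‖ ≤ B := by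
  have h1 : ContDiffOn ℝ 1 (fderiv ℝ g) Ω := hg.fderiv_of_isOpen hΩ (by norm_num)
  obtain ⟨B₁, hB₁⟩ := hS.exists_bound_of_continuousOn (h1.continuousOn.mono hSΩ)
  obtain ⟨B₂, hB₂⟩ := hS.exists_bound_of_continuousOn
    ((h1.continuousOn_fderiv_of_isOpen hΩ le_rfl).mono hSΩ)
  refine ⟨max 0 (max B₁ B₂), le_max_left _ _, fun x hx => ⟨?_, ?_⟩⟩
  · exact (hB₁ x hx).trans ((le_max_left _ _).trans (le_max_right _ _))
  · exact (hB₂ x hx).trans ((le_max_right _ _).trans (le_max_right _ _))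

/-- Bounds for the first and second derivatives of `ψ + ε κ` which are uniform in
`0 ≤ ε ≤ ε₀`. -/
theorem exists_bound_rhs {Ω S : Set (E n)} (hΩ : IsOpen Ω) (hS : IsCompact S) (hSΩ : S ⊆ Ω)
    {ψ κ : E n → ℝ} (hψ : ContDiffOn ℝ 2 ψ Ω) (hκ : ContDiffOn ℝ 2 κ Ω) (ε₀ : ℝ) :
    ∃ H, 0 ≤ H ∧ ∀ ε, 0 ≤ ε → ε ≤ ε₀ → ∀ x ∈ S, ‖fderiv ℝ (fun z => ψ z + ε * κ z) x‖ ≤ H ∧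
      ∀ ξ : E n, ‖ξ‖ = 1 → |dirDeriv ξ (dirDeriv ξ fun z => ψ z + ε * κ z) x| ≤ H := by
  obtain ⟨B₁, hB₁0, hB₁⟩ := exists_bound_derivatives hΩ hS hSΩ hψ
  obtain ⟨B₂, hB₂0, hB₂⟩ := exists_bound_derivatives hΩ hS hSΩ hκ
  refine ⟨B₁ + |ε₀| * B₂, by positivity, fun ε h0 h1 x hx => ?_⟩
  have hε : |ε| ≤ |ε₀| := abs_le_abs_of_nonneg h0 h1
  have hd : ∀ z ∈ Ω, fderiv ℝ (fun z => ψ z + ε * κ z) z = fderiv ℝ ψ z + ε • fderiv ℝ κ z := by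
    intro z hz
    have a := ((hψ.contDiffAt (hΩ.mem_nhds hz)).differentiableAt (by norm_num)).hasFDerivAt
    have b := ((hκ.contDiffAt (hΩ.mem_nhds hz)).differentiableAt (by norm_num)).hasFDerivAt
    exact (a.add (b.const_mul ε)).fderiv
  have hdd : fderiv ℝ (fderiv ℝ fun z => ψ z + ε * κ z) x =
      fderiv ℝ (fderiv ℝ ψ) x + ε • fderiv ℝ (fderiv ℝ κ) x := by
    have hnear : fderiv ℝ (fun z => ψ z + ε * κ z) =ᶠ[𝓝 x]
        fun z => fderiv ℝ ψ z + ε • fderiv ℝ κ z :=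
      eventuallyEq_of_mem (hΩ.mem_nhds (hSΩ hx)) hd
    rw [hnear.fderiv_eq]
    have hdiff : ∀ {g : E n → ℝ}, ContDiffOn ℝ 2 g Ω →
        HasFDerivAt (fderiv ℝ g) (fderiv ℝ (fderiv ℝ g) x) x := fun hg =>
      (((hg.contDiffAt (hΩ.mem_nhds (hSΩ hx))).fderiv_right (m := 1)
        (by norm_num)).differentiableAt (by norm_num)).hasFDerivAt
    exact ((hdiff hψ).add ((hdiff hκ).const_smul ε)).fderiv
  have hbd : ∀ {F : Type} [NormedAddCommGroup F] [NormedSpace ℝ F] (a b : F), ‖a‖ ≤ B₁ →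
      ‖b‖ ≤ B₂ → ‖a + ε • b‖ ≤ B₁ + |ε₀| * B₂ := by
    intro F _ _ a b ha hb
    refine (norm_add_le _ _).trans (add_le_add ha ?_)
    rw [norm_smul, Real.norm_eq_abs]
    exact mul_le_mul hε hb (norm_nonneg _) (abs_nonneg _)
  refine ⟨?_, fun ξ hξ => ?_⟩
  · rw [hd x (hSΩ hx)]
    exact hbd _ _ (hB₁ x hx).1 (hB₂ x hx).1
  · have hsm : ContDiffAt ℝ 2 (fun z => ψ z + ε * κ z) x :=
      (hψ.add (contDiffOn_const.mul hκ)).contDiffAt (hΩ.mem_nhds (hSΩ hx))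
    rw [dirDeriv_dirDeriv hsm, hdd]
    refine le_trans ?_ (hbd (F := E n →L[ℝ] E n →L[ℝ] ℝ) _ _ (hB₁ x hx).2 (hB₂ x hx).2)
    have := ContinuousLinearMap.le_opNorm₂ (fderiv ℝ (fderiv ℝ ψ) x + ε • fderiv ℝ (fderiv ℝ κ) x)
      ξ ξ
    rwa [hξ, mul_one, mul_one] at this

/-- The points of `closure Ω` at distance at least `s` from the boundary. -/
def innerSet (Ω : Set (E n)) (s : ℝ) : Set (E n) :=
  {x ∈ closure Ω | ∀ z ∈ frontier Ω, s ≤ dist x z}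

theorem isCompact_innerSet {Ω : Set (E n)} (hΩ : Bornology.IsBounded Ω) (s : ℝ) :
    IsCompact (innerSet Ω s) := by
  refine hΩ.isCompact_closure.of_isClosed_subset ?_ fun x hx => hx.1
  have : innerSet Ω s = closure Ω ∩ ⋂ z ∈ frontier Ω, {x | s ≤ dist x z} := by
    ext x; simp [innerSet]
  rw [this]
  exact isClosed_closure.inter (isClosed_biInter fun z _ =>
    isClosed_le continuous_const (continuous_id.dist continuous_const))

theorem innerSet_subset {Ω : Set (E n)} (hΩ : IsOpen Ω) {s : ℝ} (hs : 0 < s) :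
    innerSet Ω s ⊆ Ω := by
  intro x hx
  by_contra hn
  have := hx.2 x ⟨hx.1, by rwa [hΩ.interior_eq]⟩
  rw [dist_self] at this
  linarith

theorem closedBall_subset_innerSet {Ω : Set (E n)} (hΩ : IsOpen Ω) {d : ℝ} (hd : 0 < d) {x : E n}
    (hx : x ∈ innerSet Ω d) : Metric.closedBall x (d / 2) ⊆ innerSet Ω (d / 2) := by
  have hsub : Metric.closedBall x (d / 2) ⊆ Ω := by
    refine (convex_closedBall x (d / 2)).isPreconnected.subset_of_closure_inter_subset hΩ
      ⟨x, Metric.mem_closedBall_self (by linarith), innerSet_subset hΩ hd hx⟩ ?_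
    rintro z ⟨hz, hzx⟩
    by_contra hn
    have h1 := hx.2 z ⟨hz, by rwa [hΩ.interior_eq]⟩
    have h2 : dist z x ≤ d / 2 := hzx
    rw [dist_comm] at h2
    linarith
  intro y hy
  refine ⟨subset_closure (hsub hy), fun z hz => ?_⟩
  have h1 := hx.2 z hz
  have h2 : dist y x ≤ d / 2 := hy
  have h3 := dist_triangle x y z
  rw [dist_comm x y] at h3
  linarith

theorem closure_subset_innerSet {Ω Ω' : Set (E n)} {d : ℝ} (hcl : closure Ω' ⊆ Ω)
    (hdist : ENNReal.ofReal d ≤ setDist Ω' (frontier Ω)) : closure Ω' ⊆ innerSet Ω d := by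
  intro x hx
  refine ⟨subset_closure (hcl hx), fun z hz => ?_⟩
  have hclosed : IsClosed {y : E n | d ≤ dist y z} :=
    isClosed_le continuous_const (continuous_id.dist continuous_const)
  refine closure_minimal (fun y hy => ?_) hclosed hx
  have h1 : ENNReal.ofReal d ≤ edist y z :=
    hdist.trans ((iInf₂_le y hy).trans (iInf₂_le z hz))
  rw [edist_dist] at h1
  exact (ENNReal.ofReal_le_ofReal_iff dist_nonneg).1 h1

theorem norm_fderiv_le_of_c1Norm_le {Ω : Set (E n)} {u : E n → ℝ} {K : ℝ}
    (h : c1Norm Ω u ≤ ENNReal.ofReal K) {x : E n} (hx : x ∈ Ω) : ‖fderiv ℝ u x‖ ≤ max K 0 := by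
  have h1 : ‖fderiv ℝ u x‖ₑ ≤ ENNReal.ofReal K :=
    (le_iSup₂ (f := fun x (_ : x ∈ Ω) => ‖fderiv ℝ u x‖ₑ) x hx).trans (le_add_self.trans h)
  rw [← ofReal_norm] at h1
  have h2 := (ENNReal.ofReal_le_ofReal_iff' ).1 h1
  rcases h2 with h2 | h2
  · exact h2.trans (le_max_left _ _)
  · exact h2.trans (le_max_right _ _)

end Data

/-! ### The right-hand side of the approximating problem -/

section RightHandSide

variable {n : ℕ}

theorem HessianEq.IsCutoff.add_mul_pos {ε₀ : ℝ} {η : ℝ → ℝ} (hη : IsCutoff ε₀ η) (hε₀ : 0 < ε₀)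
    {ε t : ℝ} (hε : 0 < ε) (ht : 0 ≤ t) : 0 < t + ε * η t := by
  rcases le_or_gt t (ε₀ / 4) with h | h
  · rw [hη.eq_one t ⟨ht, h⟩]; linarith
  · have := mul_nonneg hε.le (hη.nonneg t ht)
    linarith

theorem HessianEq.IsCutoff.le_max {ε₀ : ℝ} {η : ℝ → ℝ} (hη : IsCutoff ε₀ η) {ε t : ℝ}
    (hε : 0 < ε) (hε' : ε ≤ ε₀ / 2) (ht : 0 ≤ t) : t + ε * η t ≤ max t ε₀ := by
  rcases le_or_gt (ε₀ / 2) t with h | h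
  · rw [hη.eq_zero t h]; simp
  · have := mul_le_mul hε' (hη.le_one t ht) (hη.nonneg t ht) (by linarith)
    exact le_max_of_le_right (by linarith)

variable {Γ : Set (Fin n → ℝ)} {f : (Fin n → ℝ) → ℝ} {Ω : Set (E n)} {ψ φ : E n → ℝ}
  {η : ℝ → ℝ} {γ ε ε₀ : ℝ} {u : E n → ℝ}

theorem HessianEq.IsAdmissibleSolution.mem (hu : IsAdmissibleSolution Γ f Ω ψ φ η γ ε u)
    (hf : StructureConditions Γ f) (hη : IsCutoff ε₀ η) (hε₀ : 0 < ε₀) (hε : 0 < ε)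
    (hψ : ∀ x ∈ Ω, 0 ≤ ψ x) {x : E n} (hx : x ∈ Ω) :
    eigenvalueVector (augHessian γ u x) ∈ Γ := by
  refine hf.mem_of_pos (hu.admissible x hx) ?_
  rw [hu.equation x hx]
  exact hη.add_mul_pos hε₀ hε (hψ x hx)

/-- As soon as the approximating problem is solvable for one choice of the parameters, the
right-hand sides for all `ε ≤ ε₀ / 2` are bounded, on a compact set, by one value of `f` in `Γ`. -/
theorem HessianEq.IsAdmissibleSolution.exists_rhs_le
    (hu : IsAdmissibleSolution Γ f Ω ψ φ η γ ε u)
    (hf : StructureConditions Γ f) (hη : IsCutoff ε₀ η) (hε₀ : 0 < ε₀) (hε : 0 < ε)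
    (hψ : ∀ x ∈ Ω, 0 ≤ ψ x) (hψc : ContinuousOn ψ Ω) (hε₀_le : ∃ μ ∈ Γ, ε₀ ≤ f μ)
    {S : Set (E n)} (hS : IsCompact S) (hSΩ : S ⊆ Ω) :
    ∃ ν ∈ Γ, ∀ δ, 0 < δ → δ ≤ ε₀ / 2 → ∀ x ∈ S, ψ x + δ * η (ψ x) ≤ f ν := by
  obtain ⟨μ, hμ, hμε⟩ := hε₀_le
  rcases S.eq_empty_or_nonempty with rfl | hne
  · exact ⟨μ, hμ, by simp⟩
  obtain ⟨x₀, hx₀, hmax⟩ := hS.exists_isMaxOn hne (hψc.mono hSΩ)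
  have hl := hu.mem hf hη hε₀ hε hψ (hSΩ hx₀)
  have hψ₀ : ψ x₀ ≤ f (eigenvalueVector (augHessian γ u x₀)) := by
    rw [hu.equation x₀ (hSΩ hx₀)]
    have := mul_nonneg hε.le (hη.nonneg _ (hψ x₀ (hSΩ hx₀)))
    linarith
  have key : ∀ a, ψ x₀ ≤ a → ε₀ ≤ a → ∀ δ, 0 < δ → δ ≤ ε₀ / 2 → ∀ x ∈ S,
      ψ x + δ * η (ψ x) ≤ a := fun a h1 h2 δ hδ hδ' x hx =>
    (hη.le_max hδ hδ' (hψ x (hSΩ hx))).trans (max_le ((hmax hx).trans h1) h2)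
  rcases le_total (f μ) (f (eigenvalueVector (augHessian γ u x₀))) with h | h
  · exact ⟨_, hl, key _ hψ₀ (hμε.trans h)⟩
  · exact ⟨_, hμ, key _ (hψ₀.trans h) hμε⟩

theorem HessianEq.IsAdmissibleSolution.trace_hessian_nonneg [NeZero n] {x : E n}
    (hu : IsAdmissibleSolution Γ f Ω ψ φ η γ ε u) (hf : StructureConditions Γ f) (hγ : 0 < γ)
    (hx : x ∈ Ω) (hux : ContDiffAt ℝ 2 u x) : 0 ≤ (hessian u x).trace := by
  have h1 := hf.sum_nonneg (hu.admissible x hx)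
  have hA := augHessian_isHermitian hux γ
  have h2 := hA.trace_eq_sum_eigenvalues
  rw [eigenvalueVector_eq hA] at h1
  simp only [RCLike.ofReal_real_eq_id, id_eq] at h2
  rw [← h2, trace_augHessian] at h1
  exact nonneg_of_mul_nonneg_right h1 (by positivity)

end RightHandSide

/-! ### The interior second derivative estimate -/

theorem theorem4p1 {n : ℕ} (hn : 2 ≤ n)
    (Γ : Set (Fin n → ℝ)) (f : (Fin n → ℝ) → ℝ) (hf : StructureConditions Γ f)
    (Ω : Set (EuclideanSpace ℝ (Fin n))) (hΩ : IsBoundedSmoothDomain Ω)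
    (ψ : EuclideanSpace ℝ (Fin n) → ℝ) (hψ : ContDiffOn ℝ ∞ ψ (closure Ω))
    (hψ_nonneg : ∀ x ∈ Ω, 0 ≤ ψ x)
    (φ : EuclideanSpace ℝ (Fin n) → ℝ) (hφ : ContDiff ℝ ∞ φ)
    (ε₀ : ℝ) (hε₀ : 0 < ε₀) (hε₀_le : ∃ μ ∈ Γ, ε₀ ≤ f μ)
    (η : ℝ → ℝ) (hη : IsCutoff ε₀ η)
    (Λ d K : ℝ) (hd : 0 < d) :
    ∃ C : ℝ, ∀ γ : ℝ, 0 < γ → γ⁻¹ ≤ Λ →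
      ∀ ε : ℝ, 0 < ε → ε ≤ ε₀ / 2 →
      ∀ u : EuclideanSpace ℝ (Fin n) → ℝ,
        IsAdmissibleSolution Γ f Ω ψ φ η γ ε u →
        c1Norm Ω u ≤ ENNReal.ofReal K →
      ∀ Ω' : Set (EuclideanSpace ℝ (Fin n)), closure Ω' ⊆ Ω →
        ENNReal.ofReal d ≤ setDist Ω' (frontier Ω) →
      ∀ x ∈ closure Ω', hessianNorm u x ≤ C := by
  have : NeZero n := ⟨by omega⟩
  -- `f` may be bounded; only the existence of some solution keeps `ψ` below `sup f` inside `Ω`.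
  by_cases hex : ∃ γ ε u, 0 < ε ∧ IsAdmissibleSolution Γ f Ω ψ φ η γ ε u
  swap
  · exact ⟨0, fun γ _ _ ε hε _ u hu => absurd ⟨γ, ε, u, hε, hu⟩ hex⟩
  obtain ⟨γ₁, ε₁, u₁, hε₁, hu₁⟩ := hex
  have hr : 0 < d / 2 := by linarith
  set r := d / 2 with hrdef
  have hΩo := hΩ.isOpen
  have hScomp := isCompact_innerSet hΩ.isBounded r
  have hSΩ := innerSet_subset hΩo hr
  have hψΩ : ContDiffOn ℝ ∞ ψ Ω := hψ.mono subset_closure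
  have hψ2 : ContDiffOn ℝ 2 ψ Ω := contDiffOn_infty.1 hψΩ 2
  have hκ : ContDiffOn ℝ 2 (fun z => η (ψ z)) Ω :=
    contDiffOn_infty.1 (hη.contDiffOn.comp hψΩ hψ_nonneg) 2
  obtain ⟨H, hH0, hH⟩ := exists_bound_rhs hΩo hScomp hSΩ hψ2 hκ ε₀
  obtain ⟨ν, hν, hνle⟩ := hu₁.exists_rhs_le hf hη hε₀ hε₁ hψ_nonneg hψ2.continuousOn hε₀_le
    hScomp hSΩ
  -- a value of `f` above all right-hand sides bounds `∑ fᵢ` from below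
  obtain ⟨ν', hν', hlt⟩ := hf.exists_gt hν
  set m := (f ν' - f ν) / (‖ν'‖ + 1) with hm
  have hm0 : 0 < m := div_pos (by linarith) (by positivity)
  set θ := 1 / (1 + |Λ|) with hθdef
  have hθ0 : 0 < θ := by positivity
  set K' := max K 0 with hK'
  have hK0 : 0 ≤ K' := le_max_right _ _
  set b := (r ^ 2 * (1 + (n * (36 * r ^ 4 + 16 * r * K') +
      (r ^ 4 * H + 2 * K' * H) / m * r ^ 4) / (2 * θ)) + K' ^ 2) / r ^ 4 with hb
  have hb0 : 0 ≤ b := by positivity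
  refine ⟨n * ((n + 1) * b), fun γ hγ hγΛ ε hε hε' u hu hK Ω' hcl hdist x hx => ?_⟩
  have hθ : θ * (1 + γ) ≤ γ := by
    have h1 : 1 ≤ γ * |Λ| := by
      rw [← inv_le_iff_one_le_mul₀' hγ]; exact hγΛ.trans (le_abs_self _)
    rw [hθdef, one_div, inv_mul_le_iff₀ (by positivity)]
    linarith
  have hxS : x ∈ innerSet Ω d := closure_subset_innerSet hcl hdist hx
  have hball : Metric.closedBall x r ⊆ innerSet Ω r := closedBall_subset_innerSet hΩo hd hxS
  have hux : ContDiffAt ℝ 2 u x :=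
    (hu.contDiffOn.contDiffAt (hΩo.mem_nhds (hcl hx))).of_le (by norm_num)
  refine hessianNorm_le hux hb0 (fun ξ hξ => ?_) (hu.trace_hessian_nonneg hf hγ (hcl hx) hux)
  refine dirDeriv_dirDeriv_center_le hf hΩo hu.contDiffOn (hψ2.add (contDiffOn_const.mul hκ)) hγ
    hθ0 hθ (fun z hz => hu.mem hf hη hε₀ hε hψ_nonneg hz) hu.equation hr (hball.trans hSΩ) hm0
    (fun z hz => norm_fderiv_le_of_c1Norm_le hK (hSΩ (hball hz)))
    (fun z hz => (hH ε hε.le (by linarith) z (hball hz)).1)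
    (fun z hz => (hH ε hε.le (by linarith) z (hball hz)).2) (fun z hz => ?_) hξ
  have hl := hu.mem hf hη hε₀ hε hψ_nonneg (hSΩ (hball hz))
  have h1 := hf.le_sum_partial hl hν'
  have h2 := hνle ε hε hε' z (hball hz)
  rw [← hu.equation z (hSΩ (hball hz))] at h2
  have h3 := (hf.sum_partial_pos hl).le
  rw [hm, div_le_iff₀ (by positivity)]
  linarith
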